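/- Let $N$ be a finite set and let $f: 2^N \to \mathbb{R} \cup \{-\infty\}$ be a valuated matroid, i.e., $\operatorname{dom} f = \{X \subseteq N : f(X) > -\infty\}$ is nonempty and, for any $X, Y \subseteq N$ and $i \in X \setminus Y$, $$ f(X) + f(Y) \le \max_{j \in Y \setminus X} \bigl\{ f((X \setminus \{i\}) \cup \{j\}) + f((Y \cup \{i\}) \setminus \{j\}) \bigr\}, $$ where $(-\infty) + a = a + (-\infty) = -\infty$ for all $a \in \mathbb{R} \cup \{-\infty\}$ and a maximum over the empty set is $-\infty$. Then $f$ has the multiple exchange property with $|J| = |I|$: for any $X, Y \subseteq N$ and $I \subseteq X \setminus Y$ there exists $J \subseteq Y \setminus X$ such that $$ f(X) + f(Y) \le f((X \setminus I) \cup J) + f((Y \setminus J) \cup I), $$ and such that moreover $|J| = |I|$ whenever $X, Y \in \operatorname{dom} f$. -/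

import Mathlib

/-- The effective domain of a set function `f : 2^N → ℝ ∪ {-∞}`. -/
def effDom {N : Type*} (f : Finset N → WithBot ℝ) : Set (Finset N) :=
  {X | f X ≠ ⊥}

/-- Valuated matroids: the effective domain is nonempty, and for all `X, Y ⊆ N`, `i ∈ X \ Y`,
`f X + f Y ≤ max_{j ∈ Y \ X} (f (X - i + j) + f (Y + i - j))`.
Addition in `WithBot ℝ` has `⊥ + a = a + ⊥ = ⊥`, and the maximum (`Finset.sup`) over the
empty set is `⊥`. -/
structure IsValuatedMatroid {N : Type*} [DecidableEq N] (f : Finset N → WithBot ℝ) : Prop where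
  nonempty_effDom : (effDom f).Nonempty
  exchange : ∀ X Y : Finset N, ∀ i ∈ X \ Y,
    f X + f Y ≤ (Y \ X).sup fun j => f ((X \ {i}) ∪ {j}) + f ((Y ∪ {i}) \ {j})

/-! The exchange is a discrete Fenchel duality. Put `W = Y \ X` and, for `P` disjoint from `W`, let
`g_P(q)` be the maximum of `f (P ∪ J) + q(J)` over `J ⊆ W` with `P ∪ J` in the domain. The required
`J` maximises `f ((X \ I) ∪ J) + f ((X ∩ Y) ∪ I ∪ (W \ J))`.

Weak side: single exchanges make `g_P` submodular in `P`, so `g_X + g_{X ∩ Y} ≤ g_{X \ I} + g_{(X ∩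
Y) ∪ I}`. Testing the left side with `∅` and `W` bounds it below by `f X + f Y + q(W)`, for every
`q`.

Strong side (`exists_partition_of_le_familyConj`): along an ultrafilter of weights on which the dual
objective tends to its infimum, the sets with slack tending to 0 form an exchange family on each
side. If `S` violated the rank condition of matroid partition, raising `q` on `S` would push the
objective below the infimum. Hence two such sets cover `W`; by cardinality they partition it, and
their total value is the infimum. -/

/-- The symmetric basis exchange property for a finite family of finite sets. -/
def IsExchangeFamily {N : Type*} [DecidableEq N] (B : Finset (Finset N)) : Prop :=
  ∀ J ∈ B, ∀ K ∈ B, ∀ i ∈ J \ K, ∃ j ∈ K \ J,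
    insert j (J.erase i) ∈ B ∧ insert i (K.erase j) ∈ B

/-- The exchange property of a real-valued function on a finite family of finite sets. -/
def IsValuatedExchangeFamily {N : Type*} [DecidableEq N] (D : Finset (Finset N))
    (v : Finset N → ℝ) : Prop :=
  ∀ J ∈ D, ∀ K ∈ D, ∀ i ∈ J \ K, ∃ j ∈ K \ J,
    insert j (J.erase i) ∈ D ∧ insert i (K.erase j) ∈ D ∧
      v J + v K ≤ v (insert j (J.erase i)) + v (insert i (K.erase j))

/-- The rank of `S` with respect to a family of sets. -/
def familyRank {N : Type*} [DecidableEq N] (B : Finset (Finset N)) (S : Finset N) : ℕ :=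
  B.sup fun J => (J ∩ S).card

/-- The conjugate `q ↦ max_{J ∈ D} (v J + q(J))` of a function on a family of sets. -/
noncomputable def familyConj {N : Type*} (D : Finset (Finset N)) (hD : D.Nonempty)
    (v : Finset N → ℝ) (q : N → ℝ) : ℝ :=
  D.sup' hD fun J => v J + ∑ x ∈ J, q x

theorem le_familyConj {N : Type*} {D : Finset (Finset N)} (hD : D.Nonempty)
    (v : Finset N → ℝ) (q : N → ℝ) {J : Finset N} (hJ : J ∈ D) : v J + ∑ x ∈ J, q x ≤ familyConj D hD v q :=
  Finset.le_sup' (fun J => v J + ∑ x ∈ J, q x) hJ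

theorem exists_eq_familyConj {N : Type*} {D : Finset (Finset N)} (hD : D.Nonempty)
    (v : Finset N → ℝ) (q : N → ℝ) : ∃ J ∈ D, familyConj D hD v q = v J + ∑ x ∈ J, q x :=
  Finset.exists_mem_eq_sup' hD _

theorem mem_effDom_of_eq_coe {N : Type*} {f : Finset N → WithBot ℝ} {X : Finset N} {x : ℝ}
    (h : f X = x) : X ∈ effDom f := by
  simp [effDom, h]

section Exchange

variable {N : Type*} [DecidableEq N]

/-! ### Submodularity of the rank of an exchange family. -/

theorem card_inter_le_familyRank {B : Finset (Finset N)} {J : Finset N} (hJ : J ∈ B)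
    (S : Finset N) : (J ∩ S).card ≤ familyRank B S :=
  Finset.le_sup (f := fun J => (J ∩ S).card) hJ

theorem exists_card_inter_eq_familyRank {B : Finset (Finset N)} (hB : B.Nonempty)
    (S : Finset N) : ∃ J ∈ B, familyRank B S = (J ∩ S).card :=
  Finset.exists_mem_eq_sup B hB _

theorem familyRank_mono (B : Finset (Finset N)) {S T : Finset N} (h : S ⊆ T) :
    familyRank B S ≤ familyRank B T :=
  Finset.sup_mono_fun fun _ _ => Finset.card_le_card (Finset.inter_subset_inter_left h)

theorem familyRank_empty (B : Finset (Finset N)) : familyRank B ∅ = 0 := by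
  simp [familyRank]

theorem card_inter_eq_sum (J S : Finset N) :
    (J ∩ S).card = ∑ x ∈ J, if x ∈ S then 1 else 0 := by
  rw [Finset.sum_boole, Finset.filter_mem_eq_inter]; rfl

theorem sum_insert_erase {M : Type*} [AddCommMonoid M] {J : Finset N} {i j : N} (hi : i ∈ J)
    (hj : j ∉ J) (w : N → M) :
    (∑ x ∈ insert j (J.erase i), w x) + w i = (∑ x ∈ J, w x) + w j := by
  rw [Finset.sum_insert (fun h => hj (Finset.mem_of_mem_erase h)), add_assoc,
    Finset.sum_erase_add _ _ hi, add_comm]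

/-- Exchange `i` out of a set optimal for `insert i S` into one optimal for `T`. The element `j`
coming back costs the second set `[j ∈ T]` and gains the first `[j ∈ S]`, which is at least as much.
-/
theorem familyRank_insert_add_le {B : Finset (Finset N)} (hB : B.Nonempty)
    (h : IsExchangeFamily B) {S T : Finset N} (hTS : T ⊆ S) {i : N} (hi : i ∉ S) :
    familyRank B (insert i S) + familyRank B T ≤
      familyRank B S + familyRank B (insert i T) := by
  obtain ⟨J, hJ, hJr⟩ := exists_card_inter_eq_familyRank hB (insert i S)
  obtain ⟨K, hK, hKr⟩ := exists_card_inter_eq_familyRank hB T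
  have hiT : i ∉ T := fun hT => hi (hTS hT)
  by_cases hiJ : i ∈ J
  · rw [Finset.inter_insert_of_mem hiJ,
      Finset.card_insert_of_notMem (by simp [hi])] at hJr
    by_cases hiK : i ∈ K
    · have h1 := card_inter_le_familyRank hJ S
      have h2 := card_inter_le_familyRank hK (insert i T)
      rw [Finset.inter_insert_of_mem hiK,
        Finset.card_insert_of_notMem (by simp [hiT])] at h2
      omega
    · obtain ⟨j, hj, hJ', hK'⟩ := h J hJ K hK i (by simp [hiJ, hiK])
      rw [Finset.mem_sdiff] at hj
      have h1 := card_inter_le_familyRank hJ' S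
      have h2 := card_inter_le_familyRank hK' (insert i T)
      have e1 := sum_insert_erase hiJ hj.2 (fun x => if x ∈ S then 1 else 0)
      have e2 := sum_insert_erase hj.1 hiK (fun x => if x ∈ insert i T then 1 else 0)
      rw [← card_inter_eq_sum, ← card_inter_eq_sum] at e1 e2
      rw [Finset.inter_insert_of_notMem hiK] at e2
      have hij : j ≠ i := by rintro rfl; exact hj.2 hiJ
      simp only [Finset.mem_insert, true_or, if_true, hij, false_or, hi, if_false] at e1 e2
      have h3 : (if j ∈ T then 1 else 0) ≤ (if j ∈ S then 1 else 0 : ℕ) := by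
        by_cases hjT : j ∈ T
        · simp [hjT, hTS hjT]
        · simp [hjT]
      omega
  · rw [Finset.inter_insert_of_notMem hiJ] at hJr
    have h1 := card_inter_le_familyRank hJ S
    have h2 := familyRank_mono B (Finset.subset_insert i T)
    omega

theorem familyRank_union_add_le {B : Finset (Finset N)} (hB : B.Nonempty)
    (h : IsExchangeFamily B) {S T : Finset N} (hTS : T ⊆ S) (U : Finset N) :
    familyRank B (S ∪ U) + familyRank B T ≤ familyRank B S + familyRank B (T ∪ U) := by
  induction U using Finset.induction_on with
  | empty => simp
  | insert i U _ ih =>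
    rw [Finset.union_insert, Finset.union_insert]
    by_cases hi : i ∈ S ∪ U
    · rw [Finset.insert_eq_of_mem hi]
      have := familyRank_mono B (Finset.subset_insert i (T ∪ U))
      omega
    · have := familyRank_insert_add_le hB h (Finset.union_subset_union_left (t := U) hTS) hi
      omega

/-! ### Contraction and matroid partition. -/

theorem IsExchangeFamily.filter_mem {B : Finset (Finset N)} (h : IsExchangeFamily B) (w : N) :
    IsExchangeFamily (B.filter (w ∈ ·)) := by
  intro J hJ K hK i hi
  rw [Finset.mem_filter] at hJ hK
  obtain ⟨j, hj, hJ', hK'⟩ := h J hJ.1 K hK.1 i hi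
  rw [Finset.mem_sdiff] at hi hj
  refine ⟨j, by simp [hj], ?_, ?_⟩
  · refine Finset.mem_filter.2 ⟨hJ', Finset.mem_insert_of_mem (Finset.mem_erase.2 ⟨?_, hJ.2⟩)⟩
    rintro rfl; exact hi.2 hK.2
  · refine Finset.mem_filter.2 ⟨hK', Finset.mem_insert_of_mem (Finset.mem_erase.2 ⟨?_, hK.2⟩)⟩
    rintro rfl; exact hj.2 hJ.2

/-- Exchanging `w` from a member containing it into an optimal set costs that set only one element.
This transfers the rank condition to the contraction by `w`. -/
theorem familyRank_insert_le_filter {B : Finset (Finset N)} (h : IsExchangeFamily B) {w : N}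
    (hw : (B.filter (w ∈ ·)).Nonempty) (S : Finset N) :
    familyRank B (insert w S) ≤ familyRank (B.filter (w ∈ ·)) S + 1 := by
  obtain ⟨L, hL⟩ := hw
  rw [Finset.mem_filter] at hL
  obtain ⟨J, hJ, hJr⟩ := exists_card_inter_eq_familyRank ⟨L, hL.1⟩ (insert w S)
  by_cases hwJ : w ∈ J
  · have hJ' : J ∈ B.filter (w ∈ ·) := Finset.mem_filter.2 ⟨hJ, hwJ⟩
    have h1 := card_inter_le_familyRank hJ' S
    rw [hJr, Finset.inter_insert_of_mem hwJ]
    exact (Finset.card_insert_le _ _).trans (by omega)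
  · obtain ⟨j, hj, -, hJ'⟩ := h L hL.1 J hJ w (by simp [hL.2, hwJ])
    have h1 := card_inter_le_familyRank
      (Finset.mem_filter.2 ⟨hJ', Finset.mem_insert_self _ _⟩ : _ ∈ B.filter (w ∈ ·)) S
    rw [hJr, Finset.inter_insert_of_notMem hwJ]
    have h2 : (J ∩ S).card - 1 ≤ ((insert w (J.erase j)) ∩ S).card := by
      refine (Finset.pred_card_le_card_erase (a := j)).trans (Finset.card_le_card ?_)
      intro x hx
      simp only [Finset.mem_erase, Finset.mem_inter, Finset.mem_insert] at hx ⊢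
      tauto
    omega

/-- The matroid partition theorem: if `|S| ≤ r₁ S + r₂ S` for all `S ⊆ W`, then `W` is covered
by two bases. -/
theorem exists_cover_of_card_le_familyRank (W : Finset N) :
    ∀ {B₁ B₂ : Finset (Finset N)}, B₁.Nonempty → B₂.Nonempty →
      IsExchangeFamily B₁ → IsExchangeFamily B₂ →
      (∀ S ⊆ W, S.card ≤ familyRank B₁ S + familyRank B₂ S) →
      ∃ J ∈ B₁, ∃ K ∈ B₂, W ⊆ J ∪ K := by
  have filter_nonempty : ∀ {B : Finset (Finset N)} {w : N}, 1 ≤ familyRank B {w} →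
      (B.filter (w ∈ ·)).Nonempty := by
    intro B w hr
    have hB : B.Nonempty := by
      rw [Finset.nonempty_iff_ne_empty]; rintro rfl; simp [familyRank] at hr
    obtain ⟨J, hJ, hJr⟩ := exists_card_inter_eq_familyRank hB {w}
    refine ⟨J, Finset.mem_filter.2 ⟨hJ, ?_⟩⟩
    by_contra hw
    rw [Finset.inter_singleton_of_notMem hw, Finset.card_empty] at hJr
    omega
  induction W using Finset.induction_on with
  | empty =>
    rintro B₁ B₂ ⟨J, hJ⟩ ⟨K, hK⟩ - - -
    exact ⟨J, hJ, K, hK, Finset.empty_subset _⟩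
  | insert w W hw ih =>
    intro B₁ B₂ hB₁ hB₂ h₁ h₂ hr
    -- This is what is needed to cover `w` by the first family and contract it there; `c₂` is the
    -- symmetric condition.
    by_cases c₁ : ∀ S ⊆ W, S.card + 1 ≤ familyRank B₁ (insert w S) + familyRank B₂ S
    · have hne : (B₁.filter (w ∈ ·)).Nonempty := by
        refine filter_nonempty ?_
        simpa [familyRank_empty] using c₁ ∅ (Finset.empty_subset _)
      obtain ⟨J, hJ, K, hK, hc⟩ := ih hne hB₂ (h₁.filter_mem w) h₂ (fun S hS => by
        have := c₁ S hS
        have := familyRank_insert_le_filter h₁ hne S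
        omega)
      rw [Finset.mem_filter] at hJ
      exact ⟨J, hJ.1, K, hK, Finset.insert_subset (Finset.mem_union_left _ hJ.2) hc⟩
    by_cases c₂ : ∀ S ⊆ W, S.card + 1 ≤ familyRank B₁ S + familyRank B₂ (insert w S)
    · have hne : (B₂.filter (w ∈ ·)).Nonempty := by
        refine filter_nonempty ?_
        simpa [familyRank_empty] using c₂ ∅ (Finset.empty_subset _)
      obtain ⟨J, hJ, K, hK, hc⟩ := ih hB₁ hne h₁ (h₂.filter_mem w) (fun S hS => by
        have := c₂ S hS
        have := familyRank_insert_le_filter h₂ hne S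
        omega)
      rw [Finset.mem_filter] at hK
      exact ⟨J, hJ, K, hK.1, Finset.insert_subset (Finset.mem_union_right _ hK.2) hc⟩
    exfalso
    push Not at c₁ c₂
    obtain ⟨S, hS, hSr⟩ := c₁
    obtain ⟨T, hT, hTr⟩ := c₂
    -- Uncrossing: adding the two violated conditions gives a violation of `hr` at `insert w (S ∪
    -- T)` or at `S ∩ T`.
    have a₁ := familyRank_union_add_le hB₁ h₁ (Finset.inter_subset_right : S ∩ T ⊆ T)
      (insert w S)
    have a₂ := familyRank_union_add_le hB₂ h₂ (Finset.inter_subset_left : S ∩ T ⊆ S)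
      (insert w T)
    rw [Finset.union_insert, Finset.union_insert, Finset.union_eq_right.2
      (Finset.inter_subset_left : S ∩ T ⊆ S), Finset.union_comm T S] at a₁
    rw [Finset.union_insert, Finset.union_insert, Finset.union_eq_right.2
      (Finset.inter_subset_right : S ∩ T ⊆ T)] at a₂
    have hST : S ∪ T ⊆ W := Finset.union_subset hS hT
    have b₁ := hr (insert w (S ∪ T)) (Finset.insert_subset_insert _ hST)
    rw [Finset.card_insert_of_notMem (fun h => hw (hST h))] at b₁
    have b₂ := hr (S ∩ T) ((Finset.inter_subset_left.trans hS).trans (Finset.subset_insert _ _))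
    have := Finset.card_union_add_card_inter S T
    omega

/-! ### Fenchel duality along an ultrafilter. -/

open Filter Topology in
open scoped Classical in
/-- Along an ultrafilter of weights, the asymptotically optimal members of a valuated exchange
family form an exchange family, and control the growth of the conjugate. -/
theorem exists_asymptotic_family {D : Finset (Finset N)} (hD : D.Nonempty) {v : Finset N → ℝ}
    (hv : IsValuatedExchangeFamily D v) (u : Ultrafilter (N → ℝ)) (W : Finset N) :
    ∃ B ⊆ D, B.Nonempty ∧ IsExchangeFamily B ∧
      (∀ J ∈ B, Tendsto (fun q => familyConj D hD v q - (v J + ∑ x ∈ J, q x)) u (𝓝 0)) ∧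
      ∃ ρ > (0 : ℝ), ∀ t ≥ (0 : ℝ), t * W.card ≤ ρ → ∀ᶠ q in (u : Filter (N → ℝ)), ∀ S ⊆ W,
        familyConj D hD v (fun x => q x + if x ∈ S then t else 0) ≤
          familyConj D hD v q + t * familyRank B S := by
  set s : Finset N → (N → ℝ) → ℝ := fun J q => familyConj D hD v q - (v J + ∑ x ∈ J, q x)
    with hs
  have s_nonneg : ∀ J ∈ D, ∀ q, 0 ≤ s J q := fun J hJ q => sub_nonneg.2 (le_familyConj hD v q hJ)
  set B := D.filter fun J => Tendsto (s J) u (𝓝 0) with hB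
  -- For an ultrafilter, failing to be eventually at least `ρ` means being eventually below `ρ`; if
  -- this held for all `ρ > 0`, the nonnegative slack would tend to 0.
  have gap : ∀ J ∈ D, J ∉ B → ∃ ρ > 0, ∀ᶠ q in (u : Filter (N → ℝ)), ρ ≤ s J q := by
    intro J hJ hJB
    by_contra! hcon
    refine hJB (Finset.mem_filter.2 ⟨hJ, ?_⟩)
    rw [tendsto_order]
    refine ⟨fun a ha => Eventually.of_forall fun q => ha.trans_le (s_nonneg J hJ q),
      fun a ha => ?_⟩
    exact hcon a ha
  have gap' : ∃ ρ > 0, ∀ᶠ q in (u : Filter (N → ℝ)), ∀ J ∈ D, J ∉ B → ρ ≤ s J q := by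
    choose! ρ hρ hρs using gap
    refine ⟨D.inf' hD (fun J => if J ∈ B then 1 else ρ J), ?_, ?_⟩
    · rw [gt_iff_lt, Finset.lt_inf'_iff]
      intro J hJ
      split_ifs with h
      · exact one_pos
      · exact hρ J hJ h
    · rw [Filter.eventually_all_finset]
      intro J hJ
      by_cases h : J ∈ B
      · exact Eventually.of_forall fun q hq => absurd h hq
      · filter_upwards [hρs J hJ h] with q hq _
        refine le_trans (Finset.inf'_le _ hJ) ?_
        rwa [if_neg h]
  obtain ⟨ρ, hρ, hρs⟩ := gap'
  have tend : ∀ J ∈ B, Tendsto (s J) u (𝓝 0) := fun J hJ => (Finset.mem_filter.1 hJ).2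
  refine ⟨B, Finset.filter_subset _ _, ?_, ?_, tend, ρ, hρ, ?_⟩
  · obtain ⟨q, hq⟩ := hρs.exists
    obtain ⟨J, hJ, hJq⟩ := exists_eq_familyConj hD v q
    refine ⟨J, ?_⟩
    by_contra hJB
    have := hq J hJ hJB
    simp only [hs, hJq] at this
    linarith
  · intro J hJ K hK i hi
    have hJD := (Finset.mem_filter.1 hJ).1
    have hKD := (Finset.mem_filter.1 hK).1
    obtain ⟨j, hj, hJ', hK', hval⟩ := hv J hJD K hKD i hi
    have hsum : ∀ q, s (insert j (J.erase i)) q + s (insert i (K.erase j)) q ≤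
        s J q + s K q := by
      intro q
      rw [Finset.mem_sdiff] at hi hj
      have e1 := sum_insert_erase hi.1 hj.2 q
      have e2 := sum_insert_erase hj.1 hi.2 q
      simp only [hs]
      linarith
    have hlim : Tendsto (fun q => s J q + s K q) u (𝓝 0) := by
      simpa using (tend J hJ).add (tend K hK)
    refine ⟨j, hj, Finset.mem_filter.2 ⟨hJ', ?_⟩, Finset.mem_filter.2 ⟨hK', ?_⟩⟩
    · refine squeeze_zero (s_nonneg _ hJ') (fun q => ?_) hlim
      linarith [hsum q, s_nonneg _ hK' q]
    · refine squeeze_zero (s_nonneg _ hK') (fun q => ?_) hlim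
      linarith [hsum q, s_nonneg _ hJ' q]
  · intro t ht htW
    filter_upwards [hρs] with q hq S hS
    refine Finset.sup'_le hD _ fun J hJ => ?_
    have hsum : ∑ x ∈ J, (q x + if x ∈ S then t else 0) =
        ∑ x ∈ J, q x + t * (J ∩ S).card := by
      rw [Finset.sum_add_distrib, Finset.sum_ite_mem, Finset.sum_const, nsmul_eq_mul, mul_comm t]
    rw [hsum]
    by_cases hJB : J ∈ B
    · have h1 : t * ((J ∩ S).card : ℝ) ≤ t * familyRank B S :=
        mul_le_mul_of_nonneg_left (by exact_mod_cast card_inter_le_familyRank hJB S) ht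
      linarith [le_familyConj hD v q hJ]
    -- Outside `B` the shift gains at most `t * W.card ≤ ρ`, which the slack absorbs.
    · have h1 := hq J hJ hJB
      have h2 : t * ((J ∩ S).card : ℝ) ≤ t * W.card :=
        mul_le_mul_of_nonneg_left
          (by exact_mod_cast Finset.card_le_card (Finset.inter_subset_right.trans hS)) ht
      have h3 : 0 ≤ t * (familyRank B S : ℝ) := by positivity
      simp only [hs] at h1
      linarith

open Filter Topology in
/-- The weighted partition theorem for valuated exchange families: a Fenchel-type lower bound
on the conjugates is attained by a partition of the ground set. -/
theorem exists_partition_of_le_familyConj {D₁ D₂ : Finset (Finset N)} (hD₁ : D₁.Nonempty)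
    (hD₂ : D₂.Nonempty) {v₁ v₂ : Finset N → ℝ} (hv₁ : IsValuatedExchangeFamily D₁ v₁)
    (hv₂ : IsValuatedExchangeFamily D₂ v₂) {W : Finset N} (hW₁ : ∀ J ∈ D₁, J ⊆ W)
    (hcard : ∀ J ∈ D₁, ∀ K ∈ D₂, J.card + K.card = W.card) {c : ℝ}
    (hc : ∀ q : N → ℝ, c + ∑ x ∈ W, q x ≤ familyConj D₁ hD₁ v₁ q + familyConj D₂ hD₂ v₂ q) :
    ∃ J ∈ D₁, W \ J ∈ D₂ ∧ c ≤ v₁ J + v₂ (W \ J) := by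
  set h : (N → ℝ) → ℝ := fun q =>
    familyConj D₁ hD₁ v₁ q + familyConj D₂ hD₂ v₂ q - ∑ x ∈ W, q x with hh
  have hlb : c ∈ lowerBounds (Set.range h) := by
    rintro _ ⟨q, rfl⟩
    simp only [hh]
    linarith [hc q]
  set m := sInf (Set.range h) with hm
  have hmh : ∀ q, m ≤ h q := fun q => csInf_le ⟨c, hlb⟩ (Set.mem_range_self q)
  have hcm : c ≤ m := le_csInf (Set.range_nonempty h) hlb
  have hne : (comap h (𝓝 m)).NeBot := by
    rw [comap_neBot_iff_frequently, ← mem_closure_iff_frequently]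
    exact csInf_mem_closure (Set.range_nonempty h) ⟨c, hlb⟩
  set u := Ultrafilter.of (comap h (𝓝 m))
  have hu : Tendsto h u (𝓝 m) := tendsto_comap.mono_left (Ultrafilter.of_le _)
  obtain ⟨B₁, hBD₁, hB₁, hE₁, hT₁, ρ₁, hρ₁, hr₁⟩ := exists_asymptotic_family hD₁ hv₁ u W
  obtain ⟨B₂, hBD₂, hB₂, hE₂, hT₂, ρ₂, hρ₂, hr₂⟩ := exists_asymptotic_family hD₂ hv₂ u W
  obtain ⟨J, hJ, K, hK, hJK⟩ : ∃ J ∈ B₁, ∃ K ∈ B₂, W ⊆ J ∪ K := by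
    refine exists_cover_of_card_le_familyRank W hB₁ hB₂ hE₁ hE₂ fun S hS => ?_
    by_contra! hlt
    obtain ⟨t, ht, ht₁, ht₂⟩ : ∃ t > (0 : ℝ), t * W.card ≤ ρ₁ ∧ t * W.card ≤ ρ₂ := by
      have hpos : (0 : ℝ) < W.card + 1 := by positivity
      have hρ : 0 < min ρ₁ ρ₂ := lt_min hρ₁ hρ₂
      -- The `+ 1` keeps the denominator positive when `W` is empty.
      have hle : min ρ₁ ρ₂ / (W.card + 1) * W.card ≤ min ρ₁ ρ₂ := by
        rw [div_mul_eq_mul_div, div_le_iff₀ hpos]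
        nlinarith
      exact ⟨_, div_pos hρ hpos, hle.trans (min_le_left _ _), hle.trans (min_le_right _ _)⟩
    -- At a weight within `t` of the infimum, the shift by `t` on `S` lowers `h` by at least `t`,
    -- since `S` violates the rank condition by at least 1.
    obtain ⟨q, h₁, h₂, hq⟩ := ((hr₁ t ht.le ht₁).and ((hr₂ t ht.le ht₂).and
      (hu.eventually (gt_mem_nhds (lt_add_of_pos_right m ht))))).exists
    have hmin := hmh fun x => q x + if x ∈ S then t else 0
    have hsum : ∑ x ∈ W, (q x + if x ∈ S then t else 0) = ∑ x ∈ W, q x + t * S.card := by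
      rw [Finset.sum_add_distrib, Finset.sum_ite_mem, Finset.sum_const, nsmul_eq_mul, mul_comm t,
        Finset.inter_eq_right.2 hS]
    have hlt' : t * (familyRank B₁ S + familyRank B₂ S + 1) ≤ t * (S.card : ℝ) :=
      mul_le_mul_of_nonneg_left (by exact_mod_cast hlt) ht.le
    simp only [hh, hsum] at hmin hq
    linarith [h₁ S hS, h₂ S hS]
  have hJD := hBD₁ hJ
  have hKD := hBD₂ hK
  have hKW : W \ J = K := by
    refine Finset.eq_of_subset_of_card_le (fun x hx => ?_) ?_
    · rw [Finset.mem_sdiff] at hx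
      exact (Finset.mem_union.1 (hJK hx.1)).resolve_left hx.2
    · rw [Finset.card_sdiff_of_subset (hW₁ J hJD)]
      have := hcard J hJD K hKD
      omega
  refine ⟨J, hJD, hKW ▸ hKD, ?_⟩
  -- For each `q` the constant equals `h q` minus the two slacks.
  have hlim : Tendsto (fun _ : N → ℝ => v₁ J + v₂ (W \ J)) u (𝓝 (m - 0 - 0)) := by
    refine ((hu.sub (hT₁ J hJ)).sub (hT₂ K hK)).congr fun q => ?_
    have := Finset.sum_sdiff (f := q) (hW₁ J hJD)
    simp only [hh, ← hKW]
    linarith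
  rw [tendsto_nhds_unique tendsto_const_nhds hlim]
  linarith

end Exchange

section ValuatedMatroid

variable {N : Type*} [DecidableEq N] {f : Finset N → WithBot ℝ}

/-! ### Real-valued exchange and equicardinality. -/

theorem IsValuatedMatroid.exists_exchange (hf : IsValuatedMatroid f) {X Y : Finset N} {x y : ℝ}
    (hX : f X = x) (hY : f Y = y) {i : N} (hi : i ∈ X \ Y) :
    ∃ j ∈ Y \ X, ∃ x' y' : ℝ, f ((X \ {i}) ∪ {j}) = x' ∧ f ((Y ∪ {i}) \ {j}) = y' ∧
      x + y ≤ x' + y' := by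
  have h := hf.exchange X Y i hi
  rw [hX, hY, ← WithBot.coe_add, Finset.le_sup_iff (WithBot.bot_lt_coe _)] at h
  obtain ⟨j, hj, h⟩ := h
  have hne := ((WithBot.bot_lt_coe _).trans_le h).ne'
  rw [Ne, WithBot.add_eq_bot, not_or] at hne
  obtain ⟨x', hx'⟩ := WithBot.ne_bot_iff_exists.1 hne.1
  obtain ⟨y', hy'⟩ := WithBot.ne_bot_iff_exists.1 hne.2
  refine ⟨j, hj, x', y', hx'.symm, hy'.symm, ?_⟩
  rw [← hx', ← hy'] at h
  exact_mod_cast h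

/-- All members of the effective domain of a valuated matroid have the same cardinality. -/
theorem IsValuatedMatroid.card_eq (hf : IsValuatedMatroid f) {X Y : Finset N}
    (hX : X ∈ effDom f) (hY : Y ∈ effDom f) : X.card = Y.card := by
  induction hn : (X \ Y).card generalizing X with
  | zero =>
    obtain ⟨x, hx⟩ := WithBot.ne_bot_iff_exists.1 hX
    obtain ⟨y, hy⟩ := WithBot.ne_bot_iff_exists.1 hY
    rw [Finset.card_eq_zero] at hn
    -- An element of `Y \ X` would need an exchange partner in `X \ Y`, which is empty.
    have hYX : Y ⊆ X := by
      intro i hi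
      by_contra hiX
      obtain ⟨j, hj, -⟩ := hf.exists_exchange hy.symm hx.symm (Finset.mem_sdiff.2 ⟨hi, hiX⟩)
      simp [hn] at hj
    rw [Finset.sdiff_eq_empty_iff_subset.1 hn |>.antisymm hYX]
  | succ n ih =>
    obtain ⟨x, hx⟩ := WithBot.ne_bot_iff_exists.1 hX
    obtain ⟨y, hy⟩ := WithBot.ne_bot_iff_exists.1 hY
    obtain ⟨i, hi⟩ : (X \ Y).Nonempty := by rw [← Finset.card_pos]; omega
    obtain ⟨j, hj, x', -, hx', -⟩ := hf.exists_exchange hx.symm hy.symm hi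
    have hX' : (X \ {i}) ∪ {j} ∈ effDom f := mem_effDom_of_eq_coe hx'
    rw [Finset.mem_sdiff] at hi hj
    have hsd : ((X \ {i}) ∪ {j}) \ Y = (X \ Y).erase i := by
      ext z
      simp only [Finset.mem_sdiff, Finset.mem_union, Finset.mem_singleton, Finset.mem_erase]
      constructor
      · rintro ⟨h | rfl, hz⟩
        · exact ⟨h.2, h.1, hz⟩
        · exact absurd hj.1 hz
      · tauto
    have hc := ih hX' (by
      rw [hsd, Finset.card_erase_of_mem (Finset.mem_sdiff.2 hi), hn, Nat.add_sub_cancel])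
    rw [← hc, Finset.card_union_of_disjoint
      (by simp [hj.2]), Finset.card_singleton, Finset.sdiff_singleton_eq_erase,
      Finset.card_erase_add_one hi.1]

/-! ### Fibres and submodularity of their conjugates. -/

open scoped Classical in
/-- The sets `J ⊆ W` such that `P ∪ J` is in the effective domain of `f`. -/
noncomputable def fiberDomain (f : Finset N → WithBot ℝ) (W P : Finset N) : Finset (Finset N) :=
  W.powerset.filter fun J => P ∪ J ∈ effDom f

/-- The real value of `f` at `P ∪ J`. -/
noncomputable def fiberValue (f : Finset N → WithBot ℝ) (P J : Finset N) : ℝ :=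
  (f (P ∪ J)).unbotD 0

theorem mem_fiberDomain {W P J : Finset N} :
    J ∈ fiberDomain f W P ↔ J ⊆ W ∧ P ∪ J ∈ effDom f := by
  simp [fiberDomain]

theorem coe_fiberValue {P J : Finset N} (h : P ∪ J ∈ effDom f) :
    f (P ∪ J) = fiberValue f P J := by
  obtain ⟨x, hx⟩ := WithBot.ne_bot_iff_exists.1 h
  simp [fiberValue, ← hx]

theorem fiberValue_eq {P J : Finset N} {x : ℝ} (h : f (P ∪ J) = x) : fiberValue f P J = x := by
  simp [fiberValue, h]

theorem IsValuatedMatroid.isValuatedExchangeFamily_fiber (hf : IsValuatedMatroid f)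
    {W P : Finset N} (hPW : Disjoint P W) :
    IsValuatedExchangeFamily (fiberDomain f W P) (fiberValue f P) := by
  intro J hJ K hK i hi
  rw [mem_fiberDomain] at hJ hK
  rw [Finset.mem_sdiff] at hi
  have hP : ∀ z ∈ W, z ∉ P := fun z hz hzP => Finset.disjoint_left.1 hPW hzP hz
  have hiP := hP i (hJ.1 hi.1)
  obtain ⟨j, hj, x, y, hx, hy, hxy⟩ := hf.exists_exchange (coe_fiberValue hJ.2)
    (coe_fiberValue hK.2) (i := i) (by simp [hi.1, hi.2, hiP])
  simp only [Finset.mem_sdiff, Finset.mem_union, not_or] at hj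
  have hjK : j ∈ K := hj.1.resolve_left hj.2.1
  have hij : i ≠ j := fun h => hi.2 (h ▸ hjK)
  have e₁ : (P ∪ J) \ {i} ∪ {j} = P ∪ insert j (J.erase i) := by grind
  have e₂ : (P ∪ K ∪ {i}) \ {j} = P ∪ insert i (K.erase j) := by grind
  rw [e₁] at hx
  rw [e₂] at hy
  refine ⟨j, by simp [hjK, hj.2.2], mem_fiberDomain.2 ⟨?_, mem_effDom_of_eq_coe hx⟩,
    mem_fiberDomain.2 ⟨?_, mem_effDom_of_eq_coe hy⟩, ?_⟩
  · exact Finset.insert_subset (hK.1 hjK) ((Finset.erase_subset _ _).trans hJ.1)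
  · exact Finset.insert_subset (hJ.1 hi.1) ((Finset.erase_subset _ _).trans hK.1)
  · rw [fiberValue_eq hx, fiberValue_eq hy]
    exact hxy

/-- Submodularity in `P` of the conjugate of the fibre over `P`, adding one element. -/
theorem IsValuatedMatroid.familyConj_fiber_insert_add_le (hf : IsValuatedMatroid f)
    {W S T : Finset N} (hTS : T ⊆ S) {i : N} (hiS : i ∉ S) (hiW : i ∉ W) (q : N → ℝ)
    (h₁ : (fiberDomain f W (insert i S)).Nonempty) (h₂ : (fiberDomain f W T).Nonempty) :
    ∃ (h₃ : (fiberDomain f W S).Nonempty) (h₄ : (fiberDomain f W (insert i T)).Nonempty),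
      familyConj _ h₁ (fiberValue f (insert i S)) q + familyConj _ h₂ (fiberValue f T) q ≤
        familyConj _ h₃ (fiberValue f S) q + familyConj _ h₄ (fiberValue f (insert i T)) q := by
  obtain ⟨J, hJ, hJq⟩ := exists_eq_familyConj h₁ (fiberValue f (insert i S)) q
  obtain ⟨K, hK, hKq⟩ := exists_eq_familyConj h₂ (fiberValue f T) q
  rw [mem_fiberDomain] at hJ hK
  have hiT : i ∉ T := fun h => hiS (hTS h)
  have hiJ : i ∉ J := fun h => hiW (hJ.1 h)
  have hiK : i ∉ K := fun h => hiW (hK.1 h)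
  obtain ⟨j, hj, x, y, hx, hy, hxy⟩ := hf.exists_exchange (coe_fiberValue hJ.2)
    (coe_fiberValue hK.2) (i := i) (by simp [hiK, hiT])
  simp only [Finset.mem_sdiff, Finset.mem_union, Finset.mem_insert, not_or] at hj
  obtain ⟨hjTK, ⟨hji, hjS⟩, hjJ⟩ := hj
  -- Since `T ⊆ S`, the returning element lies in the fibre part; so `i` moves between the base sets
  -- while `j` moves between `K` and `J`.
  have hjK : j ∈ K := hjTK.resolve_left fun h => hjS (hTS h)
  have hjT : j ∉ T := fun h => hjS (hTS h)
  have e₁ : (insert i S ∪ J) \ {i} ∪ {j} = S ∪ insert j J := by grind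
  have e₂ : (T ∪ K ∪ {i}) \ {j} = insert i T ∪ K.erase j := by grind
  rw [e₁] at hx
  rw [e₂] at hy
  have hJ' : insert j J ∈ fiberDomain f W S :=
    mem_fiberDomain.2 ⟨Finset.insert_subset (hK.1 hjK) hJ.1, mem_effDom_of_eq_coe hx⟩
  have hK' : K.erase j ∈ fiberDomain f W (insert i T) :=
    mem_fiberDomain.2 ⟨(Finset.erase_subset _ _).trans hK.1, mem_effDom_of_eq_coe hy⟩
  refine ⟨⟨_, hJ'⟩, ⟨_, hK'⟩, ?_⟩
  have l₁ := le_familyConj ⟨_, hJ'⟩ (fiberValue f S) q hJ'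
  have l₂ := le_familyConj ⟨_, hK'⟩ (fiberValue f (insert i T)) q hK'
  rw [fiberValue_eq hx, Finset.sum_insert hjJ] at l₁
  rw [fiberValue_eq hy] at l₂
  have := Finset.sum_erase_add K q hjK
  linarith

/-- Submodularity in `P` of the conjugate of the fibre over `P`. -/
theorem IsValuatedMatroid.familyConj_fiber_union_add_le (hf : IsValuatedMatroid f)
    {W S T : Finset N} (hTS : T ⊆ S) (U : Finset N) (q : N → ℝ) :
    Disjoint U S → Disjoint U W → ∀ (h₁ : (fiberDomain f W (S ∪ U)).Nonempty)
    (h₂ : (fiberDomain f W T).Nonempty),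
    ∃ (h₃ : (fiberDomain f W S).Nonempty) (h₄ : (fiberDomain f W (T ∪ U)).Nonempty),
      familyConj _ h₁ (fiberValue f (S ∪ U)) q + familyConj _ h₂ (fiberValue f T) q ≤
        familyConj _ h₃ (fiberValue f S) q + familyConj _ h₄ (fiberValue f (T ∪ U)) q := by
  induction U using Finset.induction_on with
  | empty =>
    rw [Finset.union_empty, Finset.union_empty]
    exact fun _ _ h₁ h₂ => ⟨h₁, h₂, le_rfl⟩
  | insert i U hiU ih =>
    rw [Finset.union_insert, Finset.union_insert]
    intro hUS hUW h₁ h₂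
    rw [Finset.disjoint_insert_left] at hUS hUW
    have hi : i ∉ S ∪ U := by simp [hUS.1, hiU]
    -- Only nonemptiness of the fibre over `S ∪ U` is wanted here, to feed the induction hypothesis;
    -- the inequality needed is the one with `T ∪ U`.
    obtain ⟨h₅, -⟩ := hf.familyConj_fiber_insert_add_le (hTS.trans Finset.subset_union_left)
      hi hUW.1 q h₁ h₂
    obtain ⟨h₃, h₆, hle⟩ := ih hUS.2 hUW.2 h₅ h₂
    obtain ⟨_, h₄, hle'⟩ := hf.familyConj_fiber_insert_add_le
      (Finset.union_subset_union_left (t := U) hTS) hi hUW.1 q h₁ h₆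
    exact ⟨h₃, h₄, by linarith⟩

/-! ### Multiple exchange. -/

theorem IsValuatedMatroid.exists_multiple_exchange (hf : IsValuatedMatroid f) {X Y I : Finset N}
    (hI : I ⊆ X \ Y) (hX : X ∈ effDom f) (hY : Y ∈ effDom f) :
    ∃ J ⊆ Y \ X, f X + f Y ≤ f ((X \ I) ∪ J) + f ((Y \ J) ∪ I) ∧ J.card = I.card := by
  set W := Y \ X with hW
  have hIX : I ⊆ X := hI.trans Finset.sdiff_subset
  have hIY : Disjoint I Y := Finset.disjoint_of_subset_left hI Finset.sdiff_disjoint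
  have hXW : Disjoint X W := Finset.disjoint_sdiff
  have hTS : X ∩ Y ⊆ X \ I := fun z hz => by
    rw [Finset.mem_inter] at hz
    exact Finset.mem_sdiff.2 ⟨hz.1, fun h => Finset.disjoint_left.1 hIY h hz.2⟩
  have hXI : X \ I ∪ I = X := Finset.sdiff_union_of_subset hIX
  have hYW : X ∩ Y ∪ W = Y := by
    rw [hW, Finset.inter_comm, Finset.union_comm, Finset.sdiff_union_inter]
  have hXm : ∅ ∈ fiberDomain f W (X \ I ∪ I) :=
    mem_fiberDomain.2 ⟨Finset.empty_subset _, by rwa [Finset.union_empty, hXI]⟩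
  have hYm : W ∈ fiberDomain f W (X ∩ Y) := mem_fiberDomain.2 ⟨subset_rfl, by rwa [hYW]⟩
  have key := fun q => hf.familyConj_fiber_union_add_le hTS I q Finset.disjoint_sdiff
    (hXW.mono_left hIX) ⟨_, hXm⟩ ⟨_, hYm⟩
  obtain ⟨h₁, h₂, -⟩ := key 0
  have hd₁ : Disjoint (X \ I) W := hXW.mono_left Finset.sdiff_subset
  have hd₂ : Disjoint (X ∩ Y ∪ I) W :=
    hXW.mono_left (Finset.union_subset Finset.inter_subset_left hIX)
  have hIX' := Finset.card_sdiff_add_card_eq_card hIX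
  have card₁ : ∀ J ∈ fiberDomain f W (X \ I), J.card = I.card := fun J hJ => by
    rw [mem_fiberDomain] at hJ
    have := hf.card_eq hJ.2 hX
    rw [Finset.card_union_of_disjoint (hd₁.mono_right hJ.1)] at this
    omega
  have card₂ : ∀ K ∈ fiberDomain f W (X ∩ Y ∪ I), I.card + K.card = W.card := fun K hK => by
    rw [mem_fiberDomain] at hK
    have := hf.card_eq hK.2 hY
    rw [Finset.card_union_of_disjoint (hd₂.mono_right hK.1), Finset.card_union_of_disjoint
      (hIY.symm.mono_left Finset.inter_subset_right)] at this
    have h := congrArg Finset.card hYW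
    rw [Finset.card_union_of_disjoint (hXW.mono_left Finset.inter_subset_left)] at h
    omega
  obtain ⟨J, hJ, hK, hle⟩ := exists_partition_of_le_familyConj h₁ h₂
    (hf.isValuatedExchangeFamily_fiber hd₁) (hf.isValuatedExchangeFamily_fiber hd₂)
    (W := W) (c := fiberValue f (X \ I ∪ I) ∅ + fiberValue f (X ∩ Y) W)
    (fun J hJ => (mem_fiberDomain.1 hJ).1)
    (fun J hJ K hK => by rw [card₁ J hJ, card₂ K hK])
    -- The dual bound: `∅` represents `X` in its fibre and `W` represents `Y`, contributing the term
    -- `∑ x ∈ W, q x`.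
    (fun q => by
      obtain ⟨_, _, h⟩ := key q
      have a₁ := le_familyConj ⟨_, hXm⟩ (fiberValue f (X \ I ∪ I)) q hXm
      have a₂ := le_familyConj ⟨_, hYm⟩ (fiberValue f (X ∩ Y)) q hYm
      rw [Finset.sum_empty] at a₁
      linarith)
  have hJW := (mem_fiberDomain.1 hJ).1
  refine ⟨J, hJW, ?_, card₁ J hJ⟩
  have eX := coe_fiberValue (mem_fiberDomain.1 hXm).2
  have eY := coe_fiberValue (mem_fiberDomain.1 hYm).2
  have eJ := coe_fiberValue (mem_fiberDomain.1 hJ).2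
  have eK := coe_fiberValue (mem_fiberDomain.1 hK).2
  rw [Finset.union_empty, hXI] at eX
  rw [hYW] at eY
  have hYJ : X ∩ Y ∪ I ∪ W \ J = Y \ J ∪ I := by
    ext z
    have h1 : z ∈ J → z ∉ X := fun h => (Finset.mem_sdiff.1 (hJW h)).2
    simp only [hW, Finset.mem_sdiff, Finset.mem_union, Finset.mem_inter]
    tauto
  rw [hYJ] at eK
  rw [eX, eY, eJ, eK]
  rw [hXI] at hle
  exact_mod_cast hle

end ValuatedMatroid

theorem theorem3 {N : Type*} [Finite N] [DecidableEq N] (f : Finset N → WithBot ℝ)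
    (hf : IsValuatedMatroid f) :
    ∀ X Y I : Finset N, I ⊆ X \ Y →
      ∃ J : Finset N, J ⊆ Y \ X ∧
        f X + f Y ≤ f ((X \ I) ∪ J) + f ((Y \ J) ∪ I) ∧
        (X ∈ effDom f → Y ∈ effDom f → J.card = I.card) := by
  intro X Y I hI
  by_cases h : X ∈ effDom f ∧ Y ∈ effDom f
  · obtain ⟨J, hJ, hle, hc⟩ := hf.exists_multiple_exchange hI h.1 h.2
    exact ⟨J, hJ, hle, fun _ _ => hc⟩
  · refine ⟨∅, Finset.empty_subset _, ?_, fun hX hY => absurd ⟨hX, hY⟩ h⟩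
    have hbot : f X + f Y = ⊥ := by
      simp only [effDom, Set.mem_ofPred_eq] at h
      rw [WithBot.add_eq_bot]
      tauto
    rw [hbot]
    exact bot_le
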